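/- Let $n\ge 4$ and let $J,h_1,h_2$ be nonzero real numbers. Write $I,X,Y,Z$ for the $2\times2$ identity and the Pauli matrices, and $X_i$, $Z_i$ for $X$, $Z$ acting on the $i$-th of $n$ qubits, $1\le i\le n$. Consider the one-dimensional Haldane Hamiltonian (with open boundary) $$\mathcal H=-J\sum_{i=1}^{n-2}Z_iX_{i+1}Z_{i+2}-h_1\sum_{i=1}^{n}X_i-h_2\sum_{i=1}^{n-1}X_iX_{i+1}.$$ Its dynamical Lie algebra $\mathfrak g_{\mathrm{Haldane}}$ is the real Lie algebra of complex $2^n\times 2^n$ matrices, with the commutator as bracket, generated by the operators $iT$, where $T$ runs over the individual terms $-JZ_iX_{i+1}Z_{i+2}$ ($1\le i\le n-2$), $-h_1X_i$ ($1\le i\le n$) and $-h_2X_iX_{i+1}$ ($1\le i\le n-1$) of $\mathcal H$. Let $X_o=(I\otimes X)^{\otimes\lfloor n/2\rfloor}\otimes I^{\otimes(n\bmod 2)}$ and $X_e=(X\otimes I)^{\otimes\lfloor n/2\rfloor}\otimes X^{\otimes(n\bmod 2)}$. Let $\mathcal P_n$ be the set of all Pauli strings $P=P_1\otimes\cdots\otimes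 P_n$ for which there is a set of sites $\boldsymbol j\subseteq\{1,\dots,n\}$, possibly empty, such that $\boldsymbol j$ contains an even number of even sites and an even number of odd sites, $P_k\in\{Y,Z\}$ for $k\in\boldsymbol j$, and $P_k\in\{X,I\}$ for $k\notin\boldsymbol j$. Then $$\mathfrak g_{\mathrm{Haldane}}=\operatorname{span}_{\mathbb R}\bigl\{\,iP : P\in\mathcal P_n\setminus\{I^{\otimes n},X_o,X_e,X^{\otimes n}\}\bigr\},$$ and $\dim_{\mathbb R}\mathfrak g_{\mathrm{Haldane}}=4^{n-1}-4$. -/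

import Mathlib

-- The Lie bracket on matrices is the commutator `A * B - B * A`.
attribute [local instance 100] LieRing.ofAssociativeRing

noncomputable section

namespace Haldane

/-- The labels of the four single-qubit Pauli matrices. -/
inductive Pauli where
  | I | X | Y | Z
  deriving DecidableEq

/-- The single-qubit Pauli matrices. -/
def Pauli.matrix : Pauli → Matrix (Fin 2) (Fin 2) ℂ
  | .I => 1
  | .X => !![0, 1; 1, 0]
  | .Y => !![0, -Complex.I; Complex.I, 0]
  | .Z => !![1, 0; 0, -1]

/-- Operators on `n` qubits, as matrices in the computational basis. -/
abbrev Op (n : ℕ) : Type := Matrix (Fin n → Fin 2) (Fin n → Fin 2) ℂ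

/-- The Pauli string of a word `w`: the tensor (Kronecker) product over the sites of the
single-qubit Pauli matrices `w k`. -/
def pauliString {n : ℕ} (w : Fin n → Pauli) : Op n :=
  Matrix.of fun a b => ∏ k, (w k).matrix (a k) (b k)

/-- Sites are numbered `1, …, n` from left to right. -/
def site {n : ℕ} (k : Fin n) : ℕ := k.val + 1

/-- The word of `Z_i X_{i+1} Z_{i+2}`. -/
def wordZXZ (n i : ℕ) : Fin n → Pauli := fun k =>
  if site k = i then .Z else if site k = i + 1 then .X else if site k = i + 2 then .Z else .I

/-- The word of `X_i`. -/
def wordX (n i : ℕ) : Fin n → Pauli := fun k => if site k = i then .X else .I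

/-- The word of `X_i X_{i+1}`. -/
def wordXX (n i : ℕ) : Fin n → Pauli := fun k =>
  if site k = i then .X else if site k = i + 1 then .X else .I

/-- The individual terms of the one-dimensional Haldane Hamiltonian with open ends,
`H = -J ∑_{i=1}^{n-2} Z_i X_{i+1} Z_{i+2} - h₁ ∑_{i=1}^{n} X_i - h₂ ∑_{i=1}^{n-1} X_i X_{i+1}`. -/
def haldaneTerms (n : ℕ) (J h₁ h₂ : ℝ) : Set (Op n) :=
  {A | ∃ i : ℕ, 1 ≤ i ∧ i + 2 ≤ n ∧ A = (-J) • pauliString (wordZXZ n i)} ∪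
  {A | ∃ i : ℕ, 1 ≤ i ∧ i ≤ n ∧ A = (-h₁) • pauliString (wordX n i)} ∪
  {A | ∃ i : ℕ, 1 ≤ i ∧ i + 1 ≤ n ∧ A = (-h₂) • pauliString (wordXX n i)}

/-- The dynamical Lie algebra of a set `G` of Hermitian generators: the real Lie algebra, under
the matrix commutator, generated by the operators `i g` with `g ∈ G`. -/
def dynamicalLieAlgebra {n : ℕ} (G : Set (Op n)) : LieSubalgebra ℝ (Op n) :=
  LieSubalgebra.lieSpan ℝ (Op n) ((fun g => Complex.I • g) '' G)

/-- The word of `X_o = (𝟙 X)^{⌊n/2⌋} 𝟙^{n mod 2}`: it starts with `𝟙` at site `1`. -/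
def wordXo (n : ℕ) : Fin n → Pauli := fun k => if Even (site k) then .X else .I

/-- The word of `X_e = (X 𝟙)^{⌊n/2⌋} X^{n mod 2}`: it starts with `X` at site `1`. -/
def wordXe (n : ℕ) : Fin n → Pauli := fun k => if Odd (site k) then .X else .I

/-- The words of the Haldane family. On a set `j` of sites with an even number of even sites and
an even number of odd sites the letters are in `{Y, Z}`, and off `j` they are in `{X, I}`. The
padding off `j` may be trivial, and `j` may be empty, which gives the words in `{X, I}`. The four
words `I⋯I`, `X_o`, `X_e` and `X⋯X` are left out. -/
def haldaneWords (n : ℕ) : Set (Fin n → Pauli) :=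
  {w | ∃ j : Finset (Fin n),
      Even (j.filter fun k => Even (site k)).card ∧
      Even (j.filter fun k => Odd (site k)).card ∧
      (∀ k ∈ j, w k = .Y ∨ w k = .Z) ∧
      (∀ k ∉ j, w k = .X ∨ w k = .I)} \
  {fun _ => .I, wordXo n, wordXe n, fun _ => .X}

end Haldane

end

/-! Encode a Pauli string by flip bits `x` and phase bits `z` over `ZMod 2`. Two strings multiply,
up to a scalar, by adding their bits; they commute or anticommute according to the symplectic
pairing `x ⬝ᵥ z' + z ⬝ᵥ x'`, and in the anticommuting case the bracket of the `i`-multiples is a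
nonzero real multiple of `i` times the sum word. The Lie-theoretic question thus becomes a
combinatorial one about sets of bit words that are `PairingClosed`.

Upper bound: the generators have even phase parity on both sublattices, which addition preserves. A
word with `z = 0` and `x` constant on each sublattice pairs to zero with all such words, so no
bracket produces it (`pairingClosed_evenParities`).

Lower bound: the X and XX terms toggle flip bits near the phase support of a ZXZ term. Moving along
the chain of ZXZ terms extends this to all flip bits (`all_pairVec`). Brackets of such words give
every pure flip word that is not constant on both sublattices (`of_alternates`), and general phase
patterns are assembled from pairs at distance two (`all_of_support_lt`).

The dimension follows from trace orthogonality of Pauli strings and a kernel count for the two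
parities. -/

namespace Haldane

/-! ### Tensor products and trace orthogonality of Pauli strings -/

/-- The tensor product over the sites of single-qubit operators. -/
def siteTensor {n : ℕ} (f : Fin n → Matrix (Fin 2) (Fin 2) ℂ) : Op n :=
  Matrix.of fun a b => ∏ k, f k (a k) (b k)

theorem pauliString_eq_siteTensor {n : ℕ} (w : Fin n → Pauli) :
    pauliString w = siteTensor fun k => (w k).matrix := rfl

theorem siteTensor_mul {n : ℕ} (f g : Fin n → Matrix (Fin 2) (Fin 2) ℂ) :
    siteTensor f * siteTensor g = siteTensor fun k => f k * g k := by
  ext a b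
  simp only [siteTensor, Matrix.mul_apply, Matrix.of_apply, Finset.prod_univ_sum,
    Fintype.piFinset_univ, Finset.prod_mul_distrib]

theorem siteTensor_smul {n : ℕ} (c : Fin n → ℂ) (f : Fin n → Matrix (Fin 2) (Fin 2) ℂ) :
    (siteTensor fun k => c k • f k) = (∏ k, c k) • siteTensor f := by
  ext a b
  simp [siteTensor, Finset.prod_mul_distrib]

theorem siteTensor_one {n : ℕ} : (siteTensor fun _ : Fin n => 1) = 1 := by
  ext a b
  simp only [siteTensor, Matrix.of_apply, Matrix.one_apply]
  by_cases h : a = b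
  · simp [h]
  · obtain ⟨k, hk⟩ := Function.ne_iff.mp h
    rw [if_neg h]
    exact Finset.prod_eq_zero (Finset.mem_univ k) (if_neg hk)

theorem trace_siteTensor {n : ℕ} (f : Fin n → Matrix (Fin 2) (Fin 2) ℂ) :
    (siteTensor f).trace = ∏ k, (f k).trace := by
  simp only [siteTensor, Matrix.trace, Matrix.diag, Matrix.of_apply, Finset.prod_univ_sum,
    Fintype.piFinset_univ]

theorem Pauli.trace_matrix_mul (p q : Pauli) :
    (p.matrix * q.matrix).trace = if p = q then 2 else 0 := by
  cases p <;> cases q <;> simp [Pauli.matrix, Matrix.trace, Fin.sum_univ_two] <;>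
    norm_num

theorem Pauli.matrix_mul_self (p : Pauli) : p.matrix * p.matrix = 1 := by
  cases p <;> ext i j <;> fin_cases i <;> fin_cases j <;>
    simp [Pauli.matrix, Matrix.mul_apply, Fin.sum_univ_two]

theorem trace_pauliString_mul {n : ℕ} (v w : Fin n → Pauli) :
    (pauliString v * pauliString w).trace = if v = w then 2 ^ n else 0 := by
  rw [pauliString_eq_siteTensor, pauliString_eq_siteTensor, siteTensor_mul, trace_siteTensor]
  simp only [Pauli.trace_matrix_mul]
  by_cases h : v = w
  · simp [h]
  · obtain ⟨k, hk⟩ := Function.ne_iff.mp h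
    rw [if_neg h]
    exact Finset.prod_eq_zero (Finset.mem_univ k) (if_neg hk)

theorem pauliString_mul_self {n : ℕ} (w : Fin n → Pauli) : pauliString w * pauliString w = 1 := by
  simp only [pauliString_eq_siteTensor, siteTensor_mul, Pauli.matrix_mul_self, siteTensor_one]

instance : Fintype Pauli where
  elems := {.I, .X, .Y, .Z}
  complete p := by cases p <;> simp

/-- Multiplying a relation by one string and taking the trace isolates that string's coefficient. -/
theorem linearIndependent_I_smul_pauliString (n : ℕ) :
    LinearIndependent ℝ fun w : Fin n → Pauli => Complex.I • pauliString w := by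
  rw [Fintype.linearIndependent_iff]
  intro g hg v
  have h := congrArg (fun A : Op n => (A * pauliString v).trace) hg
  simp only [Finset.sum_mul, Matrix.trace_sum, Matrix.smul_mul, Matrix.trace_smul,
    trace_pauliString_mul, Matrix.zero_mul, Matrix.trace_zero] at h
  simpa using h

/-! ### Bit encoding and commutators -/

theorem zmod_two_eq_zero_or_one (a : ZMod 2) : a = 0 ∨ a = 1 := by
  revert a; decide

/-- The Pauli letter with given flip bit `x` and phase bit `z`. -/
def bitPauli (x z : ZMod 2) : Pauli :=
  if z = 0 then (if x = 0 then .I else .X) else (if x = 0 then .Z else .Y)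

/-- The word with given flip bits `x` and phase bits `z`. -/
def bitWord {n : ℕ} (x z : Fin n → ZMod 2) : Fin n → Pauli := fun k => bitPauli (x k) (z k)

theorem exists_bitPauli_mul (x z x' z' : ZMod 2) : ∃ c : ℂ,
    (bitPauli x z).matrix * (bitPauli x' z').matrix =
      c • (bitPauli (x + x') (z + z')).matrix := by
  have h2 : (1 : ZMod 2) + 1 = 0 := rfl
  -- Only these three phases occur, so restricting `c` to them turns the existential into a finite
  -- check.
  have key : ∀ p q r : Pauli, (∃ c : ℂ, c ∈ ({1, Complex.I, -Complex.I} : Set ℂ) ∧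
      p.matrix * q.matrix = c • r.matrix) → ∃ c : ℂ, p.matrix * q.matrix = c • r.matrix :=
    fun p q r ⟨c, _, h⟩ => ⟨c, h⟩
  apply key
  simp only [Set.mem_insert_iff, Set.mem_singleton_iff, exists_eq_or_imp, exists_eq_left]
  rcases zmod_two_eq_zero_or_one x with rfl | rfl <;>
    rcases zmod_two_eq_zero_or_one z with rfl | rfl <;>
    rcases zmod_two_eq_zero_or_one x' with rfl | rfl <;>
    rcases zmod_two_eq_zero_or_one z' with rfl | rfl <;>
    simp [bitPauli, Pauli.matrix, h2, Matrix.one_fin_two]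

/-- The character `(-1) ^ s` of `ZMod 2`. -/
def bitSign (s : ZMod 2) : ℂ := if s = 0 then 1 else -1

theorem bitSign_add (s t : ZMod 2) : bitSign (s + t) = bitSign s * bitSign t := by
  have h2 : (1 : ZMod 2) + 1 = 0 := rfl
  rcases zmod_two_eq_zero_or_one s with rfl | rfl <;>
    rcases zmod_two_eq_zero_or_one t with rfl | rfl <;> simp [bitSign, h2]

theorem bitSign_sum {ι : Type*} (s : Finset ι) (f : ι → ZMod 2) :
    bitSign (∑ i ∈ s, f i) = ∏ i ∈ s, bitSign (f i) := by
  classical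
  induction s using Finset.induction_on with
  | empty => simp [bitSign]
  | insert a s ha ih => rw [Finset.sum_insert ha, Finset.prod_insert ha, bitSign_add, ih]

theorem bitPauli_mul_comm (x z x' z' : ZMod 2) :
    (bitPauli x z).matrix * (bitPauli x' z').matrix =
      bitSign (x * z' + z * x') • ((bitPauli x' z').matrix * (bitPauli x z).matrix) := by
  have h2 : (1 : ZMod 2) + 1 = 0 := rfl
  rcases zmod_two_eq_zero_or_one x with rfl | rfl <;>
    rcases zmod_two_eq_zero_or_one z with rfl | rfl <;>
    rcases zmod_two_eq_zero_or_one x' with rfl | rfl <;>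
    rcases zmod_two_eq_zero_or_one z' with rfl | rfl <;>
    simp [bitPauli, Pauli.matrix, h2, Matrix.one_fin_two, bitSign]

theorem exists_pauliString_mul {n : ℕ} (x z x' z' : Fin n → ZMod 2) : ∃ c : ℂ,
    pauliString (bitWord x z) * pauliString (bitWord x' z') =
      c • pauliString (bitWord (x + x') (z + z')) := by
  choose c hc using fun k => exists_bitPauli_mul (x k) (z k) (x' k) (z' k)
  refine ⟨∏ k, c k, ?_⟩
  simp only [pauliString_eq_siteTensor, siteTensor_mul, ← siteTensor_smul]
  exact congrArg siteTensor (funext hc)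

theorem pauliString_mul_comm {n : ℕ} (x z x' z' : Fin n → ZMod 2) :
    pauliString (bitWord x z) * pauliString (bitWord x' z') =
      bitSign (x ⬝ᵥ z' + z ⬝ᵥ x') •
        (pauliString (bitWord x' z') * pauliString (bitWord x z)) := by
  rw [dotProduct, dotProduct, ← Finset.sum_add_distrib, bitSign_sum]
  simp only [pauliString_eq_siteTensor, siteTensor_mul, ← siteTensor_smul]
  exact congrArg siteTensor (funext fun k => bitPauli_mul_comm (x k) (z k) (x' k) (z' k))

theorem lie_I_smul_pauliString_of_commute {n : ℕ} {x z x' z' : Fin n → ZMod 2}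
    (h : x ⬝ᵥ z' + z ⬝ᵥ x' = 0) :
    ⁅Complex.I • pauliString (bitWord x z), Complex.I • pauliString (bitWord x' z')⁆ = 0 := by
  have hc := pauliString_mul_comm x z x' z'
  rw [h, bitSign, if_pos rfl, one_smul] at hc
  rw [Ring.lie_def, smul_mul_smul_comm, smul_mul_smul_comm, hc, sub_self]

/-- Anticommuting involutions have a product of square `-1`, so the phase `c` is `±i`; this is what
makes the coefficient `r = ±2` real. -/
theorem lie_I_smul_pauliString_of_anticommute {n : ℕ} {x z x' z' : Fin n → ZMod 2}
    (h : x ⬝ᵥ z' + z ⬝ᵥ x' = 1) : ∃ r : ℝ, r ≠ 0 ∧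
    ⁅Complex.I • pauliString (bitWord x z), Complex.I • pauliString (bitWord x' z')⁆ =
      r • (Complex.I • pauliString (bitWord (x + x') (z + z'))) := by
  have hc := pauliString_mul_comm x z x' z'
  rw [h, bitSign, if_neg one_ne_zero, neg_one_smul] at hc
  obtain ⟨c, hm⟩ := exists_pauliString_mul x z x' z'
  set A := pauliString (bitWord x z) with hA
  set B := pauliString (bitWord x' z') with hB
  set D := pauliString (bitWord (x + x') (z + z')) with hD
  have hAA : A * A = 1 := pauliString_mul_self _
  have hBB : B * B = 1 := pauliString_mul_self _
  have hDD : D * D = 1 := pauliString_mul_self _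
  have hsq : (A * B) * (A * B) = -1 := by
    have hBA : B * A = -(A * B) := by rw [hc, neg_neg]
    rw [mul_assoc, ← mul_assoc B A B, hBA, neg_mul, mul_assoc, hBB, mul_one, mul_neg, hAA]
  rw [hm, smul_mul_smul_comm, hDD] at hsq
  have hc2 : c * c = -1 := by
    have := congrFun (congrFun hsq 0) 0
    simpa using this
  have hcI : c = Complex.I ∨ c = -Complex.I := by
    apply mul_self_eq_mul_self_iff.mp
    rw [hc2, Complex.I_mul_I]
  have hlie : ⁅Complex.I • A, Complex.I • B⁆ = (-2 * c) • D := by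
    have hBA : B * A = -(c • D) := by rw [← hm, hc, neg_neg]
    rw [Ring.lie_def, smul_mul_smul_comm, smul_mul_smul_comm, hm, hBA, Complex.I_mul_I]
    module
  rcases hcI with rfl | rfl
  · refine ⟨-2, by norm_num, ?_⟩
    rw [hlie]
    ext a b
    simp [mul_assoc]
  · refine ⟨2, by norm_num, ?_⟩
    rw [hlie]
    ext a b
    simp [mul_assoc]

/-! ### Sublattice parities and alternation -/

/-- Closure of a set of bit words under the sum of two words with symplectic pairing `1`. -/
def PairingClosed {n : ℕ} (C : (Fin n → ZMod 2) → (Fin n → ZMod 2) → Prop) : Prop :=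
  ∀ x z x' z', C x z → C x' z' → x ⬝ᵥ z' + z ⬝ᵥ x' = 1 → C (x + x') (z + z')

/-- The indicator vector of two sites. -/
def pairVec {n : ℕ} (i j : Fin n) : Fin n → ZMod 2 := Pi.single i 1 + Pi.single j 1

/-- Even numbers of phase bits on the even sites and on the odd sites. -/
def EvenParities {n : ℕ} (z : Fin n → ZMod 2) : Prop :=
  ∑ k with Even (site k), z k = 0 ∧ ∑ k with Odd (site k), z k = 0

/-- Some two sites at distance two carry different bits. -/
def Alternates {n : ℕ} (x : Fin n → ZMod 2) : Prop :=
  ∃ i j : Fin n, j.val = i.val + 2 ∧ x i + x j = 1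

theorem zmod_two_add_eq_zero {a b : ZMod 2} (h : a + b ≠ 1) : a = b := by
  revert a b; decide

theorem bits_add_self {n : ℕ} (x : Fin n → ZMod 2) : x + x = 0 := by
  funext k; exact CharTwo.add_self_eq_zero (x k)

theorem pairVec_dotProduct {n : ℕ} (x : Fin n → ZMod 2) (i j : Fin n) :
    pairVec i j ⬝ᵥ x = x i + x j := by
  simp [pairVec, add_dotProduct]

theorem pairVec_apply_left {n : ℕ} {i j : Fin n} (h : i ≠ j) : pairVec i j i = 1 := by
  simp [pairVec, h]

theorem pairVec_apply_right {n : ℕ} {i j : Fin n} (h : i ≠ j) : pairVec i j j = 1 := by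
  simp [pairVec, h.symm]

theorem pairVec_apply_of_ne {n : ℕ} {i j k : Fin n} (hi : k ≠ i) (hj : k ≠ j) :
    pairVec i j k = 0 := by
  simp [pairVec, hi, hj]

theorem EvenParities.add {n : ℕ} {z z' : Fin n → ZMod 2} (h : EvenParities z)
    (h' : EvenParities z') : EvenParities (z + z') := by
  constructor
  · simp only [Pi.add_apply, Finset.sum_add_distrib, h.1, h'.1, add_zero]
  · simp only [Pi.add_apply, Finset.sum_add_distrib, h.2, h'.2, add_zero]

theorem evenParities_zero {n : ℕ} : EvenParities (0 : Fin n → ZMod 2) := by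
  constructor <;> simp

theorem evenParities_pairVec {n : ℕ} {i j : Fin n} (h : j.val = i.val + 2) :
    EvenParities (pairVec i j) := by
  have hs : site j = site i + 2 := by simp only [site]; omega
  have h2 : (1 : ZMod 2) + 1 = 0 := rfl
  constructor <;>
    simp only [pairVec, Pi.add_apply, Finset.sum_add_distrib, Finset.sum_filter, Pi.single_apply,
      ← ite_and]
  · have : Even (site i + 2) ↔ Even (site i) := by simp [parity_simps]
    rw [Finset.sum_eq_single i, Finset.sum_eq_single j] <;> simp +contextual [hs, this]
    split_ifs <;> simp [h2]
  · have : Odd (site i + 2) ↔ Odd (site i) := by simp [parity_simps]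
    rw [Finset.sum_eq_single i, Finset.sum_eq_single j] <;> simp +contextual [hs, this]
    split_ifs <;> simp [h2]

theorem eq_of_not_alternates {n : ℕ} {x : Fin n → ZMod 2} (h : ¬ Alternates x) :
    ∀ d : ℕ, ∀ i j : Fin n, j.val = i.val + 2 * d → x i = x j := by
  intro d
  induction d with
  | zero => intro i j hij; rw [show i = j from Fin.ext (by omega)]
  | succ d ih =>
    intro i j hij
    have hj := j.isLt
    rw [ih i ⟨i.val + 2 * d, by omega⟩ rfl]
    exact zmod_two_add_eq_zero fun h1 => h ⟨_, j, by simp only; omega, h1⟩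

theorem eq_of_not_alternates_of_parity {n : ℕ} {x : Fin n → ZMod 2} (h : ¬ Alternates x)
    {i j : Fin n} (hij : Even (site i) ↔ Even (site j)) : x i = x j := by
  simp only [site, Nat.even_iff] at hij
  rcases le_total i.val j.val with hle | hle
  · exact eq_of_not_alternates h ((j.val - i.val) / 2) i j (by omega)
  · exact (eq_of_not_alternates h ((i.val - j.val) / 2) j i (by omega)).symm

theorem exists_parity_values {n : ℕ} {x : Fin n → ZMod 2} (h : ¬ Alternates x) :
    ∃ c d : ZMod 2, ∀ k, x k = if Even (site k) then c else d := by
  have key : ∀ p : Prop, ∃ c : ZMod 2, ∀ k : Fin n, (Even (site k) ↔ p) → x k = c := by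
    intro p
    by_cases hp : ∃ k : Fin n, (Even (site k) ↔ p)
    · obtain ⟨k, hk⟩ := hp
      exact ⟨x k, fun l hl => eq_of_not_alternates_of_parity h (hl.trans hk.symm)⟩
    · exact ⟨0, fun k hk => absurd ⟨k, hk⟩ hp⟩
  obtain ⟨c, hc⟩ := key True
  obtain ⟨d, hd⟩ := key False
  refine ⟨c, d, fun k => ?_⟩
  split_ifs with hk
  · exact hc k (iff_true_intro hk)
  · exact hd k (iff_false_intro hk)

/-- Such an `x` is constant on each sublattice, so the product is a combination of the two vanishing
parity sums. This is why the four excluded strings are central. -/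
theorem EvenParities.dotProduct_eq_zero {n : ℕ} {x z : Fin n → ZMod 2} (hz : EvenParities z)
    (hx : ¬ Alternates x) : x ⬝ᵥ z = 0 := by
  obtain ⟨c, d, h⟩ := exists_parity_values hx
  have hz2 := hz.2
  simp only [← Nat.not_even_iff_odd] at hz2
  simp only [dotProduct, h, ite_mul, Finset.sum_ite, ← Finset.mul_sum, hz.1, hz2, mul_zero,
    add_zero]

/-! ### Generating all admissible words -/

namespace PairingClosed

variable {n : ℕ} {C : (Fin n → ZMod 2) → (Fin n → ZMod 2) → Prop}

theorem add_flip (hC : PairingClosed C) {x z s : Fin n → ZMod 2} (h : C x z) (hs : C s 0)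
    (hp : z ⬝ᵥ s = 1) : C (x + s) z := by
  simpa using hC x z s 0 h hs (by simpa using hp)

/-- Adding `(b, w)` and then its toggled copy cancels everything except the toggle at `k`; vanishing
phase bits at `k` keep the second pairing equal to `1`. -/
theorem add_single_of_pair (hC : PairingClosed C) {x z b w : Fin n → ZMod 2} {k : Fin n}
    (h : C x z) (hb : C b w) (hb' : C (b + Pi.single k 1) w) (hp : x ⬝ᵥ w + z ⬝ᵥ b = 1)
    (hz : z k = 0) (hw : w k = 0) : C (x + Pi.single k 1) z := by
  have h1 := hC _ _ _ _ (hC _ _ _ _ h hb hp) hb' (by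
    have e : b ⬝ᵥ w + w ⬝ᵥ b = 0 := by rw [dotProduct_comm w b, CharTwo.add_self_eq_zero]
    simp only [add_dotProduct, dotProduct_add, dotProduct_single_one, Pi.add_apply, hz, hw]
    linear_combination hp + e)
  have e1 : x + b + (b + Pi.single k 1) = x + Pi.single k 1 := by
    rw [← add_assoc, add_assoc x b b, bits_add_self, add_zero]
  have e2 : z + w + w = z := by rw [add_assoc, bits_add_self, add_zero]
  rwa [e1, e2] at h1

/-- If `z k = 1`, then X at `k` anticommutes with the word. Otherwise X at `i` followed by XX at `i,
k` leaves a net flip at `k`. -/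
theorem add_single_of_near (hC : PairingClosed C) (hX : ∀ i, C (Pi.single i 1) 0)
    (hXX : ∀ i j : Fin n, j.val = i.val + 1 → C (pairVec i j) 0) {x z : Fin n → ZMod 2}
    {i k : Fin n} (h : C x z) (hi : z i = 1) (hik : k.val ≤ i.val + 1 ∧ i.val ≤ k.val + 1) :
    C (x + Pi.single k 1) z := by
  rcases zmod_two_eq_zero_or_one (z k) with hk | hk
  · have hne : i ≠ k := by rintro rfl; simp [hi] at hk
    refine hC.add_single_of_pair h (hX i) ?_ (by simpa using hi) hk rfl
    have hne' : i.val ≠ k.val := fun h => hne (Fin.ext h)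
    rcases lt_or_gt_of_ne hne' with hlt | hlt
    · exact hXX i k (by omega)
    · have := hXX k i (by omega)
      rwa [pairVec, add_comm] at this
  · exact hC.add_flip h (hX k) (by simpa using hk)

/-- The ability to toggle site `k` passes from phase pattern `w` to a nearby pattern `z`, by making
a round trip through words with phase `w`. -/
theorem add_single_transfer (hC : PairingClosed C) (hX : ∀ i, C (Pi.single i 1) 0)
    (hXX : ∀ i j : Fin n, j.val = i.val + 1 → C (pairVec i j) 0)
    {z w b : Fin n → ZMod 2} {p q k : Fin n} (hb : C b w)
    (hzp : z p = 1) (hwq : w q = 1) (hpq : p.val ≤ q.val + 1 ∧ q.val ≤ p.val + 1)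
    (hnear : ∀ l, w l = 1 → ∃ i, z i = 1 ∧ l.val ≤ i.val + 1 ∧ i.val ≤ l.val + 1)
    (hw : ∀ y, C y w → C (y + Pi.single k 1) w) {x : Fin n → ZMod 2} (h : C x z) :
    C (x + Pi.single k 1) z := by
  rcases zmod_two_eq_zero_or_one (w k) with hk | hk
  swap
  · obtain ⟨i, hi, hik⟩ := hnear k hk
    exact hC.add_single_of_near hX hXX h hi hik
  rcases zmod_two_eq_zero_or_one (z k) with hk' | hk'
  swap
  · exact hC.add_flip h (hX k) (by simpa using hk')
  rcases zmod_two_eq_zero_or_one (x ⬝ᵥ w + z ⬝ᵥ b) with h0 | h1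
  -- A flip of `b` at `p`, where `z p = 1`, corrects the pairing from `0` to `1`.
  · have hb' := hC.add_single_of_near hX hXX hb hwq hpq
    refine hC.add_single_of_pair h hb' (hw _ hb') ?_ hk' hk
    rw [dotProduct_add, dotProduct_single_one, hzp]
    linear_combination h0
  · exact hC.add_single_of_pair h hb (hw _ hb) h1 hk' hk

theorem of_add_single (z : Fin n → ZMod 2) (h0 : C 0 z)
    (h : ∀ k x, C x z → C (x + Pi.single k 1) z) (x : Fin n → ZMod 2) : C x z := by
  have key : ∀ s : Finset (Fin n), C (∑ k ∈ s, Pi.single k (x k)) z := by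
    intro s
    induction s using Finset.induction_on with
    | empty => simpa using h0
    | insert a s ha ih =>
      rw [Finset.sum_insert ha, add_comm]
      rcases zmod_two_eq_zero_or_one (x a) with hx | hx
      · simpa [hx] using ih
      · rw [hx]; exact h a _ ih
  have := key Finset.univ
  rwa [Finset.univ_sum_single] at this

section generators

variable (hC : PairingClosed C) (hX : ∀ i, C (Pi.single i 1) 0)
  (hXX : ∀ i j : Fin n, j.val = i.val + 1 → C (pairVec i j) 0)
  (hZXZ : ∀ i m j : Fin n, m.val = i.val + 1 → j.val = i.val + 2 →
    C (Pi.single m 1) (pairVec i j))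

include hC hX hXX hZXZ

theorem zero_pairVec {i j : Fin n} (h : j.val = i.val + 2) : C 0 (pairVec i j) := by
  have hj := j.isLt
  have hne : i ≠ j := fun e => by rw [e] at h; omega
  have := hC.add_single_of_near hX hXX (k := ⟨i.val + 1, by omega⟩)
    (hZXZ i ⟨i.val + 1, by omega⟩ j rfl h) (pairVec_apply_left hne) (by simp only; omega)
  rwa [bits_add_self] at this

/-- Each site of either pair is adjacent to a site of the other, so the transfer works in both
directions. -/
theorem shift_succ {i j i' j' : Fin n} (h : j.val = i.val + 2) (h' : j'.val = i'.val + 2)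
    (hii : i'.val = i.val + 1) (k : Fin n) :
    (∀ y, C y (pairVec i j) → C (y + Pi.single k 1) (pairVec i j)) ↔
      (∀ y, C y (pairVec i' j') → C (y + Pi.single k 1) (pairVec i' j')) := by
  have hne : i ≠ j := fun e => by rw [e] at h; omega
  have hne' : i' ≠ j' := fun e => by rw [e] at h'; omega
  have l := pairVec_apply_left hne
  have r := pairVec_apply_right hne
  have l' := pairVec_apply_left hne'
  have r' := pairVec_apply_right hne'
  constructor
  · intro hk y hy
    refine hC.add_single_transfer hX hXX (hC.zero_pairVec hX hXX hZXZ h) l' l (by omega) ?_ hk hy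
    intro m hm
    by_cases hmi : m = i
    · exact ⟨i', l', by subst hmi; omega⟩
    by_cases hmj : m = j
    · exact ⟨j', r', by subst hmj; omega⟩
    rw [pairVec_apply_of_ne hmi hmj] at hm
    exact absurd hm zero_ne_one
  · intro hk y hy
    refine hC.add_single_transfer hX hXX (hC.zero_pairVec hX hXX hZXZ h') l l' (by omega) ?_ hk hy
    intro m hm
    by_cases hmi : m = i'
    · exact ⟨i, l, by subst hmi; omega⟩
    by_cases hmj : m = j'
    · exact ⟨j, r, by subst hmj; omega⟩
    rw [pairVec_apply_of_ne hmi hmj] at hm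
    exact absurd hm zero_ne_one

theorem shift_iff (k : Fin n) (d : ℕ) : ∀ {i j i' j' : Fin n}, j.val = i.val + 2 →
    j'.val = i'.val + 2 → i'.val = i.val + d →
    ((∀ y, C y (pairVec i j) → C (y + Pi.single k 1) (pairVec i j)) ↔
      (∀ y, C y (pairVec i' j') → C (y + Pi.single k 1) (pairVec i' j'))) := by
  induction d with
  | zero =>
    intro i j i' j' h h' hd
    obtain rfl : i = i' := Fin.ext (by omega)
    obtain rfl : j = j' := Fin.ext (by omega)
    rfl
  | succ d ih =>
    intro i j i' j' h h' hd
    have hj' := j'.isLt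
    exact (ih (j' := ⟨i.val + d + 2, by omega⟩) (i' := ⟨i.val + d, by omega⟩) h rfl rfl).trans
      (hC.shift_succ hX hXX hZXZ rfl h' (by simp only; omega) k)

theorem all_pairVec {i j : Fin n} (h : j.val = i.val + 2) (x : Fin n → ZMod 2) :
    C x (pairVec i j) := by
  refine of_add_single _ (hC.zero_pairVec hX hXX hZXZ h) (fun k => ?_) x
  have hj := j.isLt
  have hk := k.isLt
  -- Some distance-two pair is near `k`: the given pair around it, or one starting or ending at `k`.
  -- The first option covers the middle site when `n = 3`, which belongs to no pair.
  obtain ⟨i', j', h', hm⟩ : ∃ i' j' : Fin n, j'.val = i'.val + 2 ∧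
      ∀ y, C y (pairVec i' j') → C (y + Pi.single k 1) (pairVec i' j') := by
    by_cases hki : k.val = i.val + 1
    · refine ⟨i, j, h, fun y hy => hC.add_single_of_near hX hXX hy
        (pairVec_apply_left fun e => ?_) (by omega)⟩
      rw [e] at h
      omega
    by_cases hk2 : k.val + 2 < n
    · refine ⟨k, ⟨k.val + 2, hk2⟩, rfl, fun y hy => hC.add_single_of_near hX hXX hy
        (pairVec_apply_left fun e => ?_) (by omega)⟩
      have := congrArg Fin.val e
      simp at this
    · refine ⟨⟨k.val - 2, by omega⟩, k, by simp only; omega,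
        fun y hy => hC.add_single_of_near hX hXX hy (pairVec_apply_right fun e => ?_) (by omega)⟩
      have := congrArg Fin.val e
      simp only at this
      omega
  rcases le_total i.val i'.val with hle | hle
  · exact (hC.shift_iff hX hXX hZXZ k (i'.val - i.val) h h' (by omega)).mpr hm
  · exact (hC.shift_iff hX hXX hZXZ k (i.val - i'.val) h' h (by omega)).mp hm

/-- Two words with the same phase pair have a sum with no phase; their flips can be `0` and `s`
because `s` differs at the two sites. -/
theorem of_alternates {s : Fin n → ZMod 2} (hs : Alternates s) : C s 0 := by
  obtain ⟨i, j, h, hij⟩ := hs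
  have := hC _ _ _ _ (hC.all_pairVec hX hXX hZXZ h 0) (hC.all_pairVec hX hXX hZXZ h s)
    (by rw [zero_dotProduct, zero_add, pairVec_dotProduct, hij])
  rwa [zero_add, bits_add_self] at this

theorem all_of_exists {x₀ z : Fin n → ZMod 2} (hz : EvenParities z) (hz0 : z ≠ 0) (h : C x₀ z)
    (x : Fin n → ZMod 2) : C x z := by
  have key : ∀ y s, C y z → z ⬝ᵥ s = 1 → C (y + s) z := by
    intro y s hy hs
    refine hC.add_flip hy (hC.of_alternates hX hXX hZXZ ?_) hs
    by_contra hn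
    rw [dotProduct_comm, hz.dotProduct_eq_zero hn] at hs
    exact zero_ne_one hs
  have hx : x = x₀ + (x₀ + x) := by rw [← add_assoc, bits_add_self, zero_add]
  -- A difference of flips that pairs to `0` with `z` is split into two summands that each pair to
  -- `1`.
  rcases zmod_two_eq_zero_or_one (z ⬝ᵥ (x₀ + x)) with hp | hp
  · obtain ⟨k, hk⟩ := Function.ne_iff.mp hz0
    have hk1 : z k = 1 := (zmod_two_eq_zero_or_one (z k)).resolve_left hk
    have h1 := key _ (Pi.single k 1) h (by simpa using hk1)
    have h2 := key _ (Pi.single k 1 + (x₀ + x)) h1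
      (by rw [dotProduct_add, hp, add_zero]; simpa using hk1)
    rwa [← add_assoc, add_assoc x₀, bits_add_self, add_zero, ← hx] at h2
  · rw [hx]; exact key _ _ h hp

/-- Induction on a bound for the phase support: the last phase bit is moved two sites back by adding
a distance-two pair. -/
theorem all_of_support_lt (m : ℕ) : ∀ z : Fin n → ZMod 2, EvenParities z → z ≠ 0 →
    (∀ k : Fin n, m ≤ k.val → z k = 0) → ∀ x, C x z := by
  induction m with
  | zero => exact fun z _ hz0 hs => absurd (funext fun k => hs k (Nat.zero_le _)) hz0
  | succ m ih =>
    intro z hz hz0 hs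
    by_cases hzm : ∀ k : Fin n, k.val = m → z k = 0
    · refine ih z hz hz0 fun k hk => ?_
      rcases hk.eq_or_lt with h | h
      · exact hzm k h.symm
      · exact hs k h
    push Not at hzm
    obtain ⟨k, hkm, hk⟩ := hzm
    -- A last phase bit in the first two sites would be alone on its sublattice, contradicting even
    -- parity.
    have hm2 : 2 ≤ m := by
      by_contra hlt
      have hoff : ∀ l : Fin n, l ≠ k → (Even (site l) ↔ Even (site k)) → z l = 0 := by
        intro l hl hp
        refine hs l ?_
        have : l.val ≠ k.val := fun e => hl (Fin.ext e)
        simp only [site, Nat.even_iff] at hp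
        omega
      by_cases hev : Even (site k)
      · have h1 := hz.1
        rw [Finset.sum_eq_single_of_mem k (by simp [hev])
          (fun l hl hlk => hoff l hlk (by simpa [hev] using hl))] at h1
        exact hk h1
      · have h1 := hz.2
        simp only [← Nat.not_even_iff_odd] at h1
        rw [Finset.sum_eq_single_of_mem k (by simpa using hev)
          (fun l hl hlk => hoff l hlk (by simpa [hev] using hl))] at h1
        exact hk h1
    have hkn := k.isLt
    obtain ⟨i, hi⟩ : ∃ i : Fin n, k.val = i.val + 2 := ⟨⟨k.val - 2, by omega⟩, by simp only; omega⟩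
    have hik : i ≠ k := fun e => by rw [e] at hi; omega
    have hk1 : z k = 1 := (zmod_two_eq_zero_or_one (z k)).resolve_left hk
    have hback : z + pairVec i k + pairVec i k = z := by rw [add_assoc, bits_add_self, add_zero]
    by_cases hw : z + pairVec i k = 0
    · rw [hw, zero_add] at hback
      rw [← hback]
      exact hC.all_pairVec hX hXX hZXZ hi
    · have hall := ih _ (hz.add (evenParities_pairVec hi)) hw fun l hl => by
        by_cases hlk : l = k
        · rw [hlk, Pi.add_apply, hk1, pairVec_apply_right hik]; rfl
        · have : l.val ≠ k.val := fun e => hlk (Fin.ext e)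
          have hli : l ≠ i := by rintro rfl; omega
          rw [Pi.add_apply, pairVec_apply_of_ne hli hlk, hs l (by omega), add_zero]
      obtain ⟨l, hl⟩ := Function.ne_iff.mp hw
      have hl1 := (zmod_two_eq_zero_or_one ((z + pairVec i k) l)).resolve_left hl
      -- One flip at a site `l` of the reduced phase support makes the two words anticommute.
      have h1 := hC _ _ _ _ (hall 0) (hC.all_pairVec hX hXX hZXZ hi (Pi.single l 1))
        (by rw [zero_dotProduct, zero_add, dotProduct_single_one, hl1])
      rw [hback] at h1
      exact hC.all_of_exists hX hXX hZXZ hz hz0 h1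

theorem of_evenParities {x z : Fin n → ZMod 2} (hz : EvenParities z) (h : z ≠ 0 ∨ Alternates x) :
    C x z := by
  by_cases hz0 : z = 0
  · subst hz0
    exact hC.of_alternates hX hXX hZXZ (h.resolve_left fun h => h rfl)
  · exact hC.all_of_support_lt hX hXX hZXZ n z hz hz0
      (fun k hk => absurd k.isLt (not_lt.mpr hk)) x

end generators

end PairingClosed

/-- The admissible bit words are closed under sums of pairs with symplectic pairing `1`. -/
theorem pairingClosed_evenParities (n : ℕ) :
    PairingClosed fun x z : Fin n → ZMod 2 => EvenParities z ∧ (z ≠ 0 ∨ Alternates x) := by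
  rintro x z x' z' ⟨hz, -⟩ ⟨hz', -⟩ hp
  refine ⟨hz.add hz', ?_⟩
  -- An excluded sum forces `z = z'` and a non-alternating `x + x'`; the pairing is then `(x + x')
  -- ⬝ᵥ z = 0`, not `1`.
  by_contra hcon
  push Not at hcon
  obtain ⟨h0, hx⟩ := hcon
  obtain rfl : z = z' := by
    have : z + (z' + z') = z' := by rw [← add_assoc, h0, zero_add]
    rwa [bits_add_self, add_zero] at this
  have := hz.dotProduct_eq_zero hx
  rw [add_dotProduct, dotProduct_comm x' z, hp] at this
  exact one_ne_zero this

/-! ### The Haldane family in bit form -/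

theorem bitPauli_injective : Function.Injective2 bitPauli := by
  intro x x' z z' h
  rcases zmod_two_eq_zero_or_one x with rfl | rfl <;>
    rcases zmod_two_eq_zero_or_one z with rfl | rfl <;>
    rcases zmod_two_eq_zero_or_one x' with rfl | rfl <;>
    rcases zmod_two_eq_zero_or_one z' with rfl | rfl <;> simp_all [bitPauli]

theorem bitWord_injective {n : ℕ} :
    Function.Injective fun p : (Fin n → ZMod 2) × (Fin n → ZMod 2) => bitWord p.1 p.2 := by
  intro p q h
  have hk := fun k => bitPauli_injective (congrFun h k)
  exact Prod.ext (funext fun k => (hk k).1) (funext fun k => (hk k).2)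

theorem exists_eq_bitWord {n : ℕ} (w : Fin n → Pauli) : ∃ x z, w = bitWord x z := by
  have h : ∀ p : Pauli, ∃ x z, p = bitPauli x z := by
    rintro (_ | _ | _ | _)
    exacts [⟨0, 0, rfl⟩, ⟨1, 0, rfl⟩, ⟨1, 1, rfl⟩, ⟨0, 1, rfl⟩]
  choose x z hxz using fun k => h (w k)
  exact ⟨x, z, funext hxz⟩

theorem bitPauli_mem_YZ (x z : ZMod 2) : bitPauli x z = .Y ∨ bitPauli x z = .Z ↔ z = 1 := by
  revert x z; decide

theorem bitPauli_mem_XI (x z : ZMod 2) : bitPauli x z = .X ∨ bitPauli x z = .I ↔ z ≠ 1 := by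
  revert x z; decide

theorem even_card_filter_iff {n : ℕ} (z : Fin n → ZMod 2) (p : Fin n → Prop) [DecidablePred p] :
    Even (({k | z k = 1} : Finset (Fin n)).filter p).card ↔ ∑ k with p k, z k = 0 := by
  rw [← ZMod.natCast_eq_zero_iff_even, Finset.filter_comm, Finset.natCast_card_filter]
  have h : ∀ a : ZMod 2, (if a = 1 then 1 else 0) = a := by decide
  simp only [h]

theorem exists_sites_iff {n : ℕ} (x z : Fin n → ZMod 2) :
    (∃ j : Finset (Fin n),
      Even (j.filter fun k => Even (site k)).card ∧
      Even (j.filter fun k => Odd (site k)).card ∧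
      (∀ k ∈ j, bitWord x z k = .Y ∨ bitWord x z k = .Z) ∧
      (∀ k ∉ j, bitWord x z k = .X ∨ bitWord x z k = .I)) ↔ EvenParities z := by
  simp only [bitWord, bitPauli_mem_YZ, bitPauli_mem_XI, EvenParities, ← even_card_filter_iff]
  constructor
  · rintro ⟨j, he, ho, h1, h0⟩
    obtain rfl : j = ({k | z k = 1} : Finset (Fin n)) := by
      ext k
      simp only [Finset.mem_filter, Finset.mem_univ, true_and]
      exact ⟨h1 k, fun h => by_contra fun hk => h0 k hk h⟩
    exact ⟨he, ho⟩
  · rintro ⟨he, ho⟩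
    exact ⟨_, he, ho, by simp, by simp⟩

/-- The vector with bit `c` on the even sites and bit `d` on the odd sites. -/
def parityVec (n : ℕ) (c d : ZMod 2) : Fin n → ZMod 2 := fun k => if Even (site k) then c else d

theorem not_alternates_parityVec (n : ℕ) (c d : ZMod 2) : ¬ Alternates (parityVec n c d) := by
  rintro ⟨i, j, h, h1⟩
  have hs : Even (site j) ↔ Even (site i) := by simp [site, h, parity_simps]
  simp only [parityVec, hs, CharTwo.add_self_eq_zero, zero_ne_one] at h1

theorem central_words_eq_range (n : ℕ) :
    ({fun _ => .I, wordXo n, wordXe n, fun _ => .X} : Set (Fin n → Pauli)) =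
      Set.range fun p : ZMod 2 × ZMod 2 => bitWord (parityVec n p.1 p.2) 0 := by
  have h00 : bitWord (parityVec n 0 0) 0 = fun _ => Pauli.I := by
    funext k; simp [bitWord, parityVec, bitPauli]
  have h11 : bitWord (parityVec n 1 1) 0 = fun _ => Pauli.X := by
    funext k; simp [bitWord, parityVec, bitPauli]
  have h10 : bitWord (parityVec n 1 0) 0 = wordXo n := by
    funext k; by_cases h : Even (site k) <;> simp [bitWord, parityVec, bitPauli, wordXo, h]
  have h01 : bitWord (parityVec n 0 1) 0 = wordXe n := by
    funext k
    by_cases h : Even (site k) <;>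
      simp [bitWord, parityVec, bitPauli, wordXe, h, ← Nat.not_even_iff_odd]
  ext w
  simp only [Set.mem_insert_iff, Set.mem_singleton_iff, Set.mem_range, Prod.exists]
  constructor
  · rintro (rfl | rfl | rfl | rfl)
    exacts [⟨0, 0, h00⟩, ⟨1, 0, h10⟩, ⟨0, 1, h01⟩, ⟨1, 1, h11⟩]
  · rintro ⟨c, d, rfl⟩
    rcases zmod_two_eq_zero_or_one c with rfl | rfl <;>
      rcases zmod_two_eq_zero_or_one d with rfl | rfl
    exacts [Or.inl h00, Or.inr (Or.inr (Or.inl h01)), Or.inr (Or.inl h10),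
      Or.inr (Or.inr (Or.inr h11))]

theorem haldaneWords_eq (n : ℕ) : haldaneWords n =
    ((fun p : (Fin n → ZMod 2) × (Fin n → ZMod 2) => bitWord p.1 p.2) ''
      (Set.univ ×ˢ {z | EvenParities z})) \
      Set.range fun p : ZMod 2 × ZMod 2 => bitWord (parityVec n p.1 p.2) 0 := by
  rw [haldaneWords, central_words_eq_range]
  congr 1
  ext w
  obtain ⟨x, z, rfl⟩ := exists_eq_bitWord w
  rw [Set.mem_ofPred_eq, exists_sites_iff]
  constructor
  · exact fun h => ⟨(x, z), ⟨trivial, h⟩, rfl⟩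
  · rintro ⟨p, hp, he⟩
    obtain rfl := bitWord_injective (a₂ := (x, z)) he
    exact hp.2

theorem bitWord_mem_haldaneWords {n : ℕ} {x z : Fin n → ZMod 2} :
    bitWord x z ∈ haldaneWords n ↔ EvenParities z ∧ (z ≠ 0 ∨ Alternates x) := by
  rw [haldaneWords, central_words_eq_range, Set.mem_sdiff, Set.mem_ofPred_eq, exists_sites_iff]
  refine and_congr_right fun _ => ?_
  rw [← not_iff_not, not_not]
  push Not
  constructor
  · rintro ⟨p, hp⟩
    have := bitWord_injective (a₁ := (parityVec n p.1 p.2, 0)) (a₂ := (x, z)) hp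
    obtain ⟨rfl, rfl⟩ := Prod.mk.inj this
    exact ⟨rfl, not_alternates_parityVec n _ _⟩
  · rintro ⟨rfl, hx⟩
    obtain ⟨c, d, h⟩ := exists_parity_values hx
    obtain rfl : x = parityVec n c d := funext h
    exact ⟨(c, d), rfl⟩

/-! ### Counting the family -/

/-- The parities of the phase bits on the even sites and on the odd sites. -/
def parityHom (n : ℕ) : (Fin n → ZMod 2) →+ ZMod 2 × ZMod 2 where
  toFun z := (∑ k with Even (site k), z k, ∑ k with Odd (site k), z k)
  map_zero' := by simp
  map_add' z z' := by simp [Finset.sum_add_distrib]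

theorem parityHom_surjective {n : ℕ} (hn : 2 ≤ n) : Function.Surjective (parityHom n) := by
  rintro ⟨c, d⟩
  refine ⟨Pi.single ⟨1, by omega⟩ c + Pi.single ⟨0, by omega⟩ d, ?_⟩
  rw [map_add]
  have h1 : site (⟨1, by omega⟩ : Fin n) = 2 := rfl
  have h0 : site (⟨0, by omega⟩ : Fin n) = 1 := rfl
  have hodd : ¬ Odd 2 := by decide
  simp [parityHom, h0, h1, hodd]

theorem ncard_evenParities {n : ℕ} (hn : 2 ≤ n) :
    {z : Fin n → ZMod 2 | EvenParities z}.ncard * 4 = 2 ^ n := by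
  have hk : {z : Fin n → ZMod 2 | EvenParities z} = ((parityHom n).ker : Set (Fin n → ZMod 2)) := by
    ext z
    simp [EvenParities, parityHom, AddMonoidHom.mem_ker]
  have h := (parityHom n).ker.card_mul_index
  rw [AddSubgroup.index_ker, AddMonoidHom.range_eq_top.mpr (parityHom_surjective hn)] at h
  rw [hk, ← Nat.card_coe_set_eq]
  simpa [Nat.card_eq_fintype_card] using h

/-- There are `2 ^ n` choices of flips and `2 ^ n / 4` of phases, and the four removed words are
distinct members. -/
theorem ncard_haldaneWords {n : ℕ} (hn : 2 ≤ n) : (haldaneWords n).ncard + 4 = 4 ^ (n - 1) := by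
  have hinj : Function.Injective
      fun p : ZMod 2 × ZMod 2 => bitWord (parityVec n p.1 p.2) 0 := by
    intro p q h
    have := (Prod.mk.inj (bitWord_injective (a₁ := (parityVec n p.1 p.2, 0))
      (a₂ := (parityVec n q.1 q.2, 0)) h)).1
    refine Prod.ext ?_ ?_
    · simpa [parityVec, site, parity_simps] using congrFun this ⟨1, by omega⟩
    · simpa [parityVec, site, parity_simps] using congrFun this ⟨0, by omega⟩
  have hr : (Set.range fun p : ZMod 2 × ZMod 2 => bitWord (parityVec n p.1 p.2) 0).ncard = 4 := by
    rw [← Set.image_univ, Set.ncard_image_of_injective _ hinj, Set.ncard_univ]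
    simp [Nat.card_eq_fintype_card]
  have hsub : (Set.range fun p : ZMod 2 × ZMod 2 => bitWord (parityVec n p.1 p.2) 0) ⊆
      (fun p : (Fin n → ZMod 2) × (Fin n → ZMod 2) => bitWord p.1 p.2) ''
        (Set.univ ×ˢ {z | EvenParities z}) := by
    rintro _ ⟨p, rfl⟩
    exact ⟨(parityVec n p.1 p.2, 0), ⟨trivial, evenParities_zero⟩, rfl⟩
  have h := Set.ncard_sdiff_add_ncard_of_subset hsub (Set.toFinite _)
  rw [← haldaneWords_eq, hr, Set.ncard_image_of_injective _ bitWord_injective, Set.ncard_prod,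
    Set.ncard_univ, show Nat.card (Fin n → ZMod 2) = 2 ^ n by simp [Nat.card_eq_fintype_card]] at h
  have hev := ncard_evenParities hn
  have hpow : 4 ^ n = 4 ^ (n - 1) * 4 := by rw [← pow_succ, Nat.sub_add_cancel (by omega)]
  have hmul : (4 : ℕ) ^ n = 2 ^ n * 2 ^ n := by rw [← mul_pow]; norm_num
  rw [h]
  nlinarith

/-! ### Hamiltonian terms as bit words -/

theorem wordX_eq {n : ℕ} (i : Fin n) : wordX n (i.val + 1) = bitWord (Pi.single i 1) 0 := by
  funext k
  by_cases h : k = i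
  · simp [wordX, bitWord, bitPauli, site, h]
  · have : k.val ≠ i.val := fun e => h (Fin.ext e)
    simp [wordX, bitWord, bitPauli, site, h, this]

theorem wordXX_eq {n : ℕ} {i j : Fin n} (h : j.val = i.val + 1) :
    wordXX n (i.val + 1) = bitWord (pairVec i j) 0 := by
  have hij : i ≠ j := fun e => by rw [e] at h; omega
  funext k
  by_cases hi : k = i
  · subst hi
    simp [wordXX, bitWord, bitPauli, site, pairVec_apply_left hij]
  by_cases hj : k = j
  · subst hj
    simp [wordXX, bitWord, bitPauli, site, pairVec_apply_right hij, h]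
  have hi' : k.val ≠ i.val := fun e => hi (Fin.ext e)
  have hj' : k.val ≠ i.val + 1 := fun e => hj (Fin.ext (by omega))
  simp [wordXX, bitWord, bitPauli, site, pairVec_apply_of_ne hi hj, hi', hj']

theorem wordZXZ_eq {n : ℕ} {i m j : Fin n} (hm : m.val = i.val + 1) (h : j.val = i.val + 2) :
    wordZXZ n (i.val + 1) = bitWord (Pi.single m 1) (pairVec i j) := by
  have hij : i ≠ j := fun e => by rw [e] at h; omega
  have him : i ≠ m := fun e => by rw [e] at hm; omega
  have hmj : m ≠ j := fun e => by rw [e] at hm; omega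
  funext k
  by_cases hi : k = i
  · subst hi
    simp [wordZXZ, bitWord, bitPauli, site, pairVec_apply_left hij, him]
  by_cases hj : k = j
  · subst hj
    simp [wordZXZ, bitWord, bitPauli, site, pairVec_apply_right hij, hmj.symm, h]
  by_cases hkm : k = m
  · subst hkm
    simp [wordZXZ, bitWord, bitPauli, site, pairVec_apply_of_ne hi hj, hm]
  have hi' : k.val ≠ i.val := fun e => hi (Fin.ext e)
  have hm' : k.val ≠ i.val + 1 := fun e => hkm (Fin.ext (by omega))
  have hj' : k.val ≠ i.val + 2 := fun e => hj (Fin.ext (by omega))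
  simp [wordZXZ, bitWord, bitPauli, site, pairVec_apply_of_ne hi hj, hkm, hi', hm', hj']

/-! ### The dynamical Lie algebra and the span -/

theorem I_smul_mem_dynamicalLieAlgebra {n : ℕ} {G : Set (Op n)} {c : ℝ} (hc : c ≠ 0) {A : Op n}
    (h : c • A ∈ G) : Complex.I • A ∈ dynamicalLieAlgebra G := by
  have h1 : Complex.I • c • A ∈ dynamicalLieAlgebra G :=
    LieSubalgebra.subset_lieSpan (Set.mem_image_of_mem _ h)
  rw [smul_comm] at h1
  have h2 := (dynamicalLieAlgebra G).smul_mem c⁻¹ h1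
  rwa [inv_smul_smul₀ hc] at h2

theorem pairingClosed_of_lieSubalgebra {n : ℕ} (L : LieSubalgebra ℝ (Op n)) :
    PairingClosed fun x z => Complex.I • pauliString (bitWord x z) ∈ L := by
  intro x z x' z' h h' hp
  obtain ⟨r, hr, he⟩ := lie_I_smul_pauliString_of_anticommute hp
  have h1 := L.lie_mem h h'
  rw [he] at h1
  have h2 := L.smul_mem r⁻¹ h1
  rwa [inv_smul_smul₀ hr] at h2

/-- The real span of the operators `i P` with `P` in the Haldane family, as a Lie algebra. -/
noncomputable def haldaneSpan (n : ℕ) : LieSubalgebra ℝ (Op n) where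
  toSubmodule := Submodule.span ℝ ((fun w => Complex.I • pauliString w) '' haldaneWords n)
  lie_mem' := by
    intro A B hA hB
    change A ∈ Submodule.span ℝ _ at hA
    change B ∈ Submodule.span ℝ _ at hB
    change ⁅A, B⁆ ∈ Submodule.span ℝ _
    induction hA, hB using Submodule.span_induction₂ with
    | mem_mem A B hA hB =>
      obtain ⟨v, hv, rfl⟩ := hA
      obtain ⟨w, hw, rfl⟩ := hB
      obtain ⟨x, z, rfl⟩ := exists_eq_bitWord v
      obtain ⟨x', z', rfl⟩ := exists_eq_bitWord w
      dsimp only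
      rcases zmod_two_eq_zero_or_one (x ⬝ᵥ z' + z ⬝ᵥ x') with hp | hp
      · rw [lie_I_smul_pauliString_of_commute hp]
        exact Submodule.zero_mem _
      · obtain ⟨r, -, he⟩ := lie_I_smul_pauliString_of_anticommute hp
        rw [he]
        refine Submodule.smul_mem _ _ (Submodule.subset_span (Set.mem_image_of_mem _ ?_))
        exact bitWord_mem_haldaneWords.mpr (pairingClosed_evenParities n _ _ _ _
          (bitWord_mem_haldaneWords.mp hv) (bitWord_mem_haldaneWords.mp hw) hp)
    | zero_left B hB => rw [zero_lie]; exact Submodule.zero_mem _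
    | zero_right A hA => rw [lie_zero]; exact Submodule.zero_mem _
    | add_left A A' B _ _ _ h h' => rw [add_lie]; exact Submodule.add_mem _ h h'
    | add_right A B B' _ _ _ h h' => rw [lie_add]; exact Submodule.add_mem _ h h'
    | smul_left r A B _ _ h => rw [smul_lie]; exact Submodule.smul_mem _ _ h
    | smul_right r A B _ _ h => rw [lie_smul]; exact Submodule.smul_mem _ _ h

/-- For `4 ≤ n` every site has a partner at distance two. For `n = 3` the middle X is `X_o` itself,
so the bound matters. -/
theorem alternates_single {n : ℕ} (hn : 4 ≤ n) (i : Fin n) :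
    Alternates (Pi.single i 1 : Fin n → ZMod 2) := by
  by_cases h : i.val + 2 < n
  · have hne : (⟨i.val + 2, h⟩ : Fin n) ≠ i := fun e => by simpa using congrArg Fin.val e
    exact ⟨i, ⟨i.val + 2, h⟩, rfl, by rw [Pi.single_eq_same, Pi.single_eq_of_ne hne, add_zero]⟩
  · have hi := i.isLt
    have hne : (⟨i.val - 2, by omega⟩ : Fin n) ≠ i := fun e => by
      have := congrArg Fin.val e
      simp only at this
      omega
    exact ⟨⟨i.val - 2, by omega⟩, i, by simp only; omega,
      by rw [Pi.single_eq_same, Pi.single_eq_of_ne hne, zero_add]⟩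

theorem alternates_pairVec {n : ℕ} (hn : 4 ≤ n) {i j : Fin n} (hij : j.val = i.val + 1) :
    Alternates (pairVec i j) := by
  have hj := j.isLt
  have hne : i ≠ j := fun e => by rw [e] at hij; omega
  by_cases h : i.val + 2 < n
  · have hi' : (⟨i.val + 2, h⟩ : Fin n) ≠ i := fun e => by simpa using congrArg Fin.val e
    have hj' : (⟨i.val + 2, h⟩ : Fin n) ≠ j := fun e => by
      have := congrArg Fin.val e
      simp only at this
      omega
    exact ⟨i, ⟨i.val + 2, h⟩, rfl,
      by rw [pairVec_apply_left hne, pairVec_apply_of_ne hi' hj', add_zero]⟩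
  · have hi' : (⟨i.val - 2, by omega⟩ : Fin n) ≠ i := fun e => by
      have := congrArg Fin.val e
      simp only at this
      omega
    have hj' : (⟨i.val - 2, by omega⟩ : Fin n) ≠ j := fun e => by
      have := congrArg Fin.val e
      simp only at this
      omega
    exact ⟨⟨i.val - 2, by omega⟩, i, by simp only; omega,
      by rw [pairVec_apply_left hne, pairVec_apply_of_ne hi' hj', zero_add]⟩

theorem exists_word_of_mem_haldaneTerms {n : ℕ} (hn : 4 ≤ n) {J h₁ h₂ : ℝ} {A : Op n}
    (hA : A ∈ haldaneTerms n J h₁ h₂) :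
    ∃ c : ℝ, ∃ w ∈ haldaneWords n, A = c • pauliString w := by
  rcases hA with (⟨i, hi, hin, rfl⟩ | ⟨i, hi, hin, rfl⟩) | ⟨i, hi, hin, rfl⟩ <;>
    obtain ⟨i, rfl⟩ := Nat.exists_eq_add_of_le' hi <;> refine ⟨_, _, ?_, rfl⟩
  · rw [wordZXZ_eq (i := ⟨i, by omega⟩) (m := ⟨i + 1, by omega⟩) (j := ⟨i + 2, by omega⟩) rfl rfl]
    refine bitWord_mem_haldaneWords.mpr ⟨evenParities_pairVec rfl, Or.inl fun h => ?_⟩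
    have := congrFun h ⟨i, by omega⟩
    rw [pairVec_apply_left (fun e => by simpa using congrArg Fin.val e)] at this
    exact one_ne_zero this
  · rw [wordX_eq (⟨i, by omega⟩ : Fin n)]
    exact bitWord_mem_haldaneWords.mpr ⟨evenParities_zero, Or.inr (alternates_single hn _)⟩
  · rw [wordXX_eq (i := ⟨i, by omega⟩) (j := ⟨i + 1, by omega⟩) rfl]
    exact bitWord_mem_haldaneWords.mpr ⟨evenParities_zero, Or.inr (alternates_pairVec hn rfl)⟩

theorem dynamicalLieAlgebra_le_haldaneSpan {n : ℕ} (hn : 4 ≤ n) (J h₁ h₂ : ℝ) :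
    dynamicalLieAlgebra (haldaneTerms n J h₁ h₂) ≤ haldaneSpan n := by
  refine LieSubalgebra.lieSpan_le.mpr ?_
  rintro _ ⟨A, hA, rfl⟩
  obtain ⟨c, w, hw, rfl⟩ := exists_word_of_mem_haldaneTerms hn hA
  dsimp only
  rw [smul_comm]
  exact Submodule.smul_mem _ c (Submodule.subset_span (Set.mem_image_of_mem _ hw))

theorem I_smul_pauliString_mem_dynamicalLieAlgebra {n : ℕ} {J h₁ h₂ : ℝ}
    (hJ : J ≠ 0) (hh₁ : h₁ ≠ 0) (hh₂ : h₂ ≠ 0) {w : Fin n → Pauli} (hw : w ∈ haldaneWords n) :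
    Complex.I • pauliString w ∈ dynamicalLieAlgebra (haldaneTerms n J h₁ h₂) := by
  obtain ⟨x, z, rfl⟩ := exists_eq_bitWord w
  obtain ⟨hz, h⟩ := bitWord_mem_haldaneWords.mp hw
  refine (pairingClosed_of_lieSubalgebra
    (dynamicalLieAlgebra (haldaneTerms n J h₁ h₂))).of_evenParities ?_ ?_ ?_ hz h
  · intro i
    rw [← wordX_eq]
    exact I_smul_mem_dynamicalLieAlgebra (neg_ne_zero.mpr hh₁)
      (Or.inl (Or.inr ⟨i.val + 1, by omega, by omega, rfl⟩))
  · intro i j hij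
    rw [← wordXX_eq hij]
    exact I_smul_mem_dynamicalLieAlgebra (neg_ne_zero.mpr hh₂)
      (Or.inr ⟨i.val + 1, by omega, by omega, rfl⟩)
  · intro i m j hm hij
    rw [← wordZXZ_eq hm hij]
    exact I_smul_mem_dynamicalLieAlgebra (neg_ne_zero.mpr hJ)
      (Or.inl (Or.inl ⟨i.val + 1, by omega, by omega, rfl⟩))

theorem finrank_span_pauliStrings {n : ℕ} (S : Set (Fin n → Pauli)) :
    Module.finrank ℝ (Submodule.span ℝ ((fun w => Complex.I • pauliString w) '' S)) = S.ncard := by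
  have h := (linearIndependent_I_smul_pauliString n).comp ((↑) : S → Fin n → Pauli)
    Subtype.val_injective
  have := Fintype.ofFinite S
  have h1 := finrank_span_eq_card h
  rw [Set.range_comp, Subtype.range_coe] at h1
  rw [h1, ← Nat.card_coe_set_eq, Nat.card_eq_fintype_card]

end Haldane

theorem mainTheorem4 (n : ℕ) (hn : 4 ≤ n) (J h₁ h₂ : ℝ) (hJ : J ≠ 0) (hh₁ : h₁ ≠ 0)
    (hh₂ : h₂ ≠ 0) :
    (Haldane.dynamicalLieAlgebra (Haldane.haldaneTerms n J h₁ h₂)).toSubmodule =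
        Submodule.span ℝ
          ((fun w => Complex.I • Haldane.pauliString w) '' Haldane.haldaneWords n) ∧
      (Module.finrank ℝ (Haldane.dynamicalLieAlgebra (Haldane.haldaneTerms n J h₁ h₂)) : ℤ) =
        4 ^ (n - 1) - 4 := by
  have hspan : (Haldane.dynamicalLieAlgebra (Haldane.haldaneTerms n J h₁ h₂)).toSubmodule =
      Submodule.span ℝ
        ((fun w => Complex.I • Haldane.pauliString w) '' Haldane.haldaneWords n) := by
    apply le_antisymm
    · exact Haldane.dynamicalLieAlgebra_le_haldaneSpan hn J h₁ h₂
    · rw [Submodule.span_le]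
      rintro _ ⟨w, hw, rfl⟩
      exact Haldane.I_smul_pauliString_mem_dynamicalLieAlgebra hJ hh₁ hh₂ hw
  refine ⟨hspan, ?_⟩
  have hfin : Module.finrank ℝ (Haldane.dynamicalLieAlgebra (Haldane.haldaneTerms n J h₁ h₂)) =
      (Haldane.haldaneWords n).ncard := by
    rw [← Haldane.finrank_span_pauliStrings, ← hspan]
    rfl
  have hcard := Haldane.ncard_haldaneWords (n := n) (by omega)
  rw [hfin, eq_sub_iff_add_eq]
  exact_mod_cast hcard
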